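/- Let \(\mathbf M\) be a closed symmetric monoidal category, with tensor product \(\otimes\), unit object \(I\) and symmetric braiding \(\tau\), that is complete, cocomplete and additive. Let \(\overline{\mathbf C}=(\mathbf C,\perp)\) be an orthogonal category: a category \(\mathbf C\) with a relation \(\perp\) between morphisms with a common target that is symmetric and satisfies \((g f_1 h_1)\perp(g f_2 h_2)\) whenever \(f_1\perp f_2\) and the composites are defined. Let \(\mathbf{Alg}_{\mathsf{As}}\) be the category of algebras over the associative operad, i.e. of associative and unital algebras \((A,\mu,\eta)\) in \(\mathbf M\), and let \(\mathbf{Alg}_{\mathsf{uLie}}\) be the category of algebras over the unital Lie operad, i.e. of objects \(V\) of \(\mathbf M\) with a bracket \([\cdot,\cdot]:V\otimes V\to V\) and a unit \(\eta:I\to V\) such that the bracket is antisymmetric, \([\cdot,\cdot]=-[\cdot,\cdot]\circ\tau\), satisfies the Jacobi identity, and \([\cdot,\cdot]\circ(\mathrm{id}_V\otimes\eta)=0\). Let \(\phi^*:\mathbf{Alg}_{\mathsf{As}}\to\mathbf{Alg}_{\mathsf{uLie}}\), \((A,\mu,\eta)\mapsto(A,\mu-\mu\circ\tau,\eta)\),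 be the functor induced by the operad map \(\phi:\mathsf{uLie}\to\mathsf{As}\) that sends the unit to the unit and the bracket to the commutator. Let \(\phi_!:\mathbf{Alg}_{\mathsf{uLie}}\to\mathbf{Alg}_{\mathsf{As}}\) be the unital universal enveloping algebra functor: for \(V\in\mathbf{Alg}_{\mathsf{uLie}}\) let \(T^\otimes V=\coprod_{n\ge 0}V^{\otimes n}\) be the tensor algebra, with multiplication \(\mu_\otimes\), unit \(\eta_\otimes\) and inclusion \(\iota_1:V\to T^\otimes V\); let \(\pi:T^\otimes V\to U^\otimes V\) be the coequalizer in \(\mathbf{Alg}_{\mathsf{As}}\) of the algebra morphisms \(T^\otimes(V\otimes V)\rightrightarrows T^\otimes V\) that extend \((\mu_\otimes-\mu_\otimes\circ\tau)\circ(\iota_1\otimes\iota_1)\) and \(\iota_1\circ[\cdot,\cdot]\); and let \(U^\otimes V\to\phi_!(V)\) be the coequalizer in \(\mathbf{Alg}_{\mathsf{As}}\) of the algebra morphisms \(T^\otimes(I)\rightrightarrows U^\otimes V\) that extend \(\pi\circ\iota_1\circ\eta\) and \(\pi\circ\eta_\otimes\). Let \(\mathbf{QFT}(\overline{\mathbf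 C})\) be the full subcategory of the functor category \(\mathbf{Alg}_{\mathsf{As}}^{\mathbf C}\) on the functors \(\mathfrak A\) such that, for all \((f_1:c_1\to c)\perp(f_2:c_2\to c)\), the commutator of \(\mathfrak A(c)\) vanishes after precomposition with \(\mathfrak A(f_1)\otimes\mathfrak A(f_2)\). Let \(\mathbf{LFT}(\overline{\mathbf C})\) be the full subcategory of \(\mathbf{Alg}_{\mathsf{uLie}}^{\mathbf C}\) on the functors \(\mathfrak B\) such that, for all such pairs, the Lie bracket of \(\mathfrak B(c)\) vanishes after precomposition with \(\mathfrak B(f_1)\otimes\mathfrak B(f_2)\). Let \(\mathfrak U_{\mathsf{lin}}:\mathbf{QFT}(\overline{\mathbf C})\to\mathbf{LFT}(\overline{\mathbf C})\), \(\mathfrak A\mapsto\phi^*\circ\mathfrak A\), be the right adjoint of the linear quantization adjunction. Then: 1. \(\phi_!\) is left adjoint to \(\phi^*\). 2. For every \(\mathfrak B\in\mathbf{LFT}(\overline{\mathbf C})\), the functor \(\phi_!\circ\mathfrak B\) belongs to \(\mathbf{QFT}(\overline{\mathbf C})\). 3. The resulting functor \(\mathbf{LFT}(\overline{\mathbf C})\to\mathbf{QFT}(\overline{\mathbf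 C})\), \(\mathfrak B\mapsto\phi_!\circ\mathfrak B\), is left adjoint to \(\mathfrak U_{\mathsf{lin}}\); hence it is a model for the left adjoint \(\mathfrak Q_{\mathsf{lin}}\) of the linear quantization adjunction, i.e. every left adjoint \(\mathfrak Q_{\mathsf{lin}}\) of \(\mathfrak U_{\mathsf{lin}}\) is naturally isomorphic to it. -/

import Mathlib

open CategoryTheory Limits MonoidalCategory

namespace LinearQuantization

universe v u v₁ u₁

open scoped MonObj

/-! ### Orthogonal categories and field theories -/

/-- An orthogonality relation on a category: a relation between morphisms with a common target
that is symmetric and stable under pre- and post-composition. A category with an orthogonality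
relation is an orthogonal category. -/
structure Orthogonality (C : Type u₁) [Category.{v₁} C] where
  /-- `perp f₁ f₂` is the relation `f₁ ⊥ f₂`. -/
  perp : ∀ {c₁ c₂ c : C}, (c₁ ⟶ c) → (c₂ ⟶ c) → Prop
  symm : ∀ {c₁ c₂ c : C} {f₁ : c₁ ⟶ c} {f₂ : c₂ ⟶ c}, perp f₁ f₂ → perp f₂ f₁
  comp : ∀ {b₁ b₂ c₁ c₂ c d : C} (h₁ : b₁ ⟶ c₁) (h₂ : b₂ ⟶ c₂) {f₁ : c₁ ⟶ c} {f₂ : c₂ ⟶ c}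
    (g : c ⟶ d), perp f₁ f₂ → perp (h₁ ≫ f₁ ≫ g) (h₂ ≫ f₂ ≫ g)

/-- Let `Alg` be a category of algebras with underlying objects in `M` (given by `U`), and let
`r₁`, `r₂` be two operations of arity two, acting on all algebras. A functor `F : C ⥤ Alg` is a
field theory of type `(r₁, r₂)` if both operations agree after precomposition with
`F(f₁) ⊗ F(f₂)`, for all `f₁ ⊥ f₂`. -/
def isFieldTheory {M : Type u} [Category.{v} M] [MonoidalCategory M]
    {Alg : Type*} [Category* Alg] (U : Alg ⥤ M)
    (r₁ r₂ : ∀ A : Alg, U.obj A ⊗ U.obj A ⟶ U.obj A)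
    {C : Type u₁} [Category.{v₁} C] (O : Orthogonality C) : ObjectProperty (C ⥤ Alg) :=
  fun F => ∀ ⦃c₁ c₂ c : C⦄ (f₁ : c₁ ⟶ c) (f₂ : c₂ ⟶ c), O.perp f₁ f₂ →
    (U.map (F.map f₁) ⊗ₘ U.map (F.map f₂)) ≫ r₁ (F.obj c) =
      (U.map (F.map f₁) ⊗ₘ U.map (F.map f₂)) ≫ r₂ (F.obj c)

section TensorAlgebra

variable {M : Type u} [Category.{v} M] [MonoidalCategory M] [SymmetricCategory M]
  [MonoidalClosed M] [HasColimits M]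

/-! ### The tensor algebra -/

/-- The tensor powers `V^{⊗ n}`. -/
def tensorPow (V : M) : ℕ → M
  | 0 => 𝟙_ M
  | n + 1 => V ⊗ tensorPow V n

/-- The (identity) isomorphism `V^{⊗ 0} ≅ 𝟙`. -/
def powZero (V : M) : tensorPow V 0 ≅ 𝟙_ M := Iso.refl _

/-- The (identity) isomorphism `V^{⊗ (n + 1)} ≅ V ⊗ V^{⊗ n}`. -/
def powSucc (V : M) (n : ℕ) : tensorPow V (n + 1) ≅ V ⊗ tensorPow V n := Iso.refl _

/-- The object `T^⊗ V = ∐ₙ V^{⊗ n}`. -/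
noncomputable def tensorAlgObj (V : M) : M := ∐ tensorPow V

/-- The inclusion `V^{⊗ n} ⟶ T^⊗ V`. -/
noncomputable def incl (V : M) (n : ℕ) : tensorPow V n ⟶ tensorAlgObj V := Sigma.ι (tensorPow V) n

/-- A morphism `T^⊗ V ⟶ Z` defined on the summands `V^{⊗ n}`. -/
noncomputable def descT {V Z : M} (f : ∀ n, tensorPow V n ⟶ Z) : tensorAlgObj V ⟶ Z :=
  Sigma.desc f

/-- A morphism `Y ⊗ T^⊗ V ⟶ Z` defined on the summands `Y ⊗ V^{⊗ n}`. -/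
noncomputable def descR {V Y Z : M} (f : ∀ n, Y ⊗ tensorPow V n ⟶ Z) : Y ⊗ tensorAlgObj V ⟶ Z :=
  MonoidalClosed.uncurry (descT fun n => MonoidalClosed.curry (f n))

/-- A morphism `T^⊗ V ⊗ Y ⟶ Z` defined on the summands `V^{⊗ n} ⊗ Y`. -/
noncomputable def descL {V Y Z : M} (f : ∀ n, tensorPow V n ⊗ Y ⟶ Z) : tensorAlgObj V ⊗ Y ⟶ Z :=
  (β_ (tensorAlgObj V) Y).hom ≫ descR fun n => (β_ Y (tensorPow V n)).hom ≫ f n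

lemma incl_descT {V Z : M} (f : ∀ n, tensorPow V n ⟶ Z) (n : ℕ) : incl V n ≫ descT f = f n :=
  Sigma.ι_desc f n

lemma whiskerLeft_incl_descR {V Y Z : M} (f : ∀ n, Y ⊗ tensorPow V n ⟶ Z) (n : ℕ) :
    Y ◁ incl V n ≫ descR f = f n := by
  rw [descR, ← MonoidalClosed.uncurry_natural_left, incl_descT, MonoidalClosed.uncurry_curry]

lemma incl_whiskerRight_descL {V Y Z : M} (f : ∀ n, tensorPow V n ⊗ Y ⟶ Z) (n : ℕ) :
    incl V n ▷ Y ≫ descL f = f n := by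
  rw [descL, BraidedCategory.braiding_naturality_left_assoc, whiskerLeft_incl_descR,
    SymmetricCategory.symmetry_assoc]

lemma hom_ext_T {V Z : M} {f g : tensorAlgObj V ⟶ Z} (h : ∀ n, incl V n ≫ f = incl V n ≫ g) :
    f = g := Sigma.hom_ext _ _ h

lemma hom_ext_R {V Y Z : M} {f g : Y ⊗ tensorAlgObj V ⟶ Z}
    (h : ∀ n, Y ◁ incl V n ≫ f = Y ◁ incl V n ≫ g) : f = g := by
  apply MonoidalClosed.curry_injective
  refine hom_ext_T fun n => ?_
  rw [← MonoidalClosed.curry_natural_left, ← MonoidalClosed.curry_natural_left, h]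

lemma hom_ext_L {V Y Z : M} {f g : tensorAlgObj V ⊗ Y ⟶ Z}
    (h : ∀ n, incl V n ▷ Y ≫ f = incl V n ▷ Y ≫ g) : f = g := by
  rw [← cancel_epi (β_ Y (tensorAlgObj V)).hom]
  refine hom_ext_R fun n => ?_
  rw [BraidedCategory.braiding_naturality_right_assoc,
    BraidedCategory.braiding_naturality_right_assoc, h]

/-- The unit `𝟙 = V^{⊗ 0} ⟶ T^⊗ V`. -/
noncomputable def unitT (V : M) : 𝟙_ M ⟶ tensorAlgObj V := (powZero V).inv ≫ incl V 0

/-- Adding a factor on the left, `V ⊗ T^⊗ V ⟶ T^⊗ V`: it identifies `V ⊗ V^{⊗ n}` with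
`V^{⊗ (n + 1)}`. -/
noncomputable def consT (V : M) : V ⊗ tensorAlgObj V ⟶ tensorAlgObj V :=
  descR fun n => (powSucc V n).inv ≫ incl V (n + 1)

/-- Adding `n` factors on the left, `V^{⊗ n} ⊗ T^⊗ V ⟶ T^⊗ V`. -/
noncomputable def concatT (V : M) : ∀ n, tensorPow V n ⊗ tensorAlgObj V ⟶ tensorAlgObj V
  | 0 => (powZero V).hom ▷ _ ≫ (λ_ (tensorAlgObj V)).hom
  | n + 1 => (powSucc V n).hom ▷ _ ≫ (α_ V (tensorPow V n) (tensorAlgObj V)).hom ≫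
      V ◁ concatT V n ≫ consT V

/-- The multiplication of `T^⊗ V`: concatenation of tensors. -/
noncomputable def mulT (V : M) : tensorAlgObj V ⊗ tensorAlgObj V ⟶ tensorAlgObj V :=
  descL (concatT V)

lemma incl_consT (V : M) (n : ℕ) :
    V ◁ incl V n ≫ consT V = (powSucc V n).inv ≫ incl V (n + 1) :=
  whiskerLeft_incl_descR _ n

lemma incl_mulT (V : M) (n : ℕ) : incl V n ▷ tensorAlgObj V ≫ mulT V = concatT V n :=
  incl_whiskerRight_descL _ n

lemma hom_ext_LR {V X Y Z : M} {f g : X ⊗ (tensorAlgObj V ⊗ Y) ⟶ Z}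
    (h : ∀ n, X ◁ incl V n ▷ Y ≫ f = X ◁ incl V n ▷ Y ≫ g) : f = g := by
  apply MonoidalClosed.curry_injective
  refine hom_ext_L fun n => ?_
  rw [← MonoidalClosed.curry_natural_left, ← MonoidalClosed.curry_natural_left, h]

lemma consT_mulT (V : M) :
    consT V ▷ tensorAlgObj V ≫ mulT V =
      (α_ V (tensorAlgObj V) (tensorAlgObj V)).hom ≫ V ◁ mulT V ≫ consT V := by
  rw [← cancel_epi (α_ V (tensorAlgObj V) (tensorAlgObj V)).inv]
  refine hom_ext_LR fun n => ?_
  rw [Iso.inv_hom_id_assoc, ← MonoidalCategory.whiskerLeft_comp_assoc, incl_mulT,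
    associator_inv_naturality_middle_assoc, ← comp_whiskerRight_assoc, incl_consT,
    comp_whiskerRight_assoc, incl_mulT, concatT]
  simp

lemma concatT_mulT (V : M) (n : ℕ) :
    concatT V n ▷ tensorAlgObj V ≫ mulT V =
      (α_ (tensorPow V n) (tensorAlgObj V) (tensorAlgObj V)).hom ≫ tensorPow V n ◁ mulT V ≫
        concatT V n := by
  induction n with
  | zero =>
    simp only [concatT, comp_whiskerRight, Category.assoc, whisker_exchange_assoc]
    simp
  | succ n ih =>
    simp only [concatT, comp_whiskerRight, Category.assoc, consT_mulT,
      associator_naturality_middle_assoc]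
    rw [← MonoidalCategory.whiskerLeft_comp_assoc, ih, whisker_exchange_assoc]
    simp

lemma concatT_unitT (V : M) (n : ℕ) :
    tensorPow V n ◁ unitT V ≫ concatT V n = (ρ_ (tensorPow V n)).hom ≫ incl V n := by
  induction n with
  | zero =>
    rw [concatT, whisker_exchange_assoc, leftUnitor_naturality, unitT, unitors_equal,
      rightUnitor_naturality_assoc]
    simp
  | succ n ih =>
    rw [concatT, whisker_exchange_assoc, associator_naturality_right_assoc,
      ← MonoidalCategory.whiskerLeft_comp_assoc, ih, MonoidalCategory.whiskerLeft_comp_assoc,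
      incl_consT]
    simp

/-- The tensor algebra `T^⊗ V` as an associative and unital algebra. -/
noncomputable instance (V : M) : MonObj (tensorAlgObj V) where
  one := unitT V
  mul := mulT V
  one_mul := by
    rw [unitT, comp_whiskerRight_assoc, incl_mulT, concatT, ← comp_whiskerRight_assoc]
    simp
  mul_one := by
    refine hom_ext_L fun n => ?_
    rw [← whisker_exchange_assoc, incl_mulT, concatT_unitT, rightUnitor_naturality]
  mul_assoc := by
    rw [← cancel_epi (α_ (tensorAlgObj V) (tensorAlgObj V) (tensorAlgObj V)).inv]
    refine hom_ext_L fun n => ?_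
    rw [Iso.inv_hom_id_assoc, ← whisker_exchange_assoc, incl_mulT,
      associator_inv_naturality_left_assoc, ← comp_whiskerRight_assoc, incl_mulT, concatT_mulT,
      Iso.inv_hom_id_assoc]

/-- The tensor algebra `T^⊗ V`, the free associative and unital algebra on `V`. -/
noncomputable abbrev tensorAlg (V : M) : Mon M := ⟨tensorAlgObj V⟩

/-- The inclusion `ι₁ : V ≅ V^{⊗ 1} ⟶ T^⊗ V`. -/
noncomputable def ι₁ (V : M) : V ⟶ (tensorAlg V).X :=
  (ρ_ V).inv ≫ V ◁ (powZero V).inv ≫ (powSucc V 0).inv ≫ incl V 1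

/-- The morphism `V^{⊗ n} ⟶ A`, `v₁ ⊗ ⋯ ⊗ vₙ ↦ f(v₁) ⋯ f(vₙ)`. -/
noncomputable def liftPow {V : M} (A : Mon M) (f : V ⟶ A.X) : ∀ n, tensorPow V n ⟶ A.X
  | 0 => (powZero V).hom ≫ η[A.X]
  | n + 1 => (powSucc V n).hom ≫ (f ⊗ₘ liftPow A f n) ≫ μ[A.X]

lemma consT_lift {V : M} (A : Mon M) (f : V ⟶ A.X) :
    consT V ≫ descT (liftPow A f) = (f ⊗ₘ descT (liftPow A f)) ≫ μ[A.X] := by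
  refine hom_ext_R fun n => ?_
  rw [← Category.assoc, incl_consT, Category.assoc, incl_descT, liftPow, Iso.inv_hom_id_assoc,
    whiskerLeft_comp_tensorHom_assoc, incl_descT]

lemma concatT_lift {V : M} (A : Mon M) (f : V ⟶ A.X) (n : ℕ) :
    concatT V n ≫ descT (liftPow A f) = (liftPow A f n ⊗ₘ descT (liftPow A f)) ≫ μ[A.X] := by
  induction n with
  | zero =>
    simp only [concatT, liftPow, MonoidalCategory.tensorHom_def, comp_whiskerRight,
      Category.assoc, ← whisker_exchange_assoc, MonObj.one_mul]
    simp [whisker_exchange_assoc]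
  | succ n ih =>
    simp only [concatT, Category.assoc, consT_lift]
    rw [whiskerLeft_comp_tensorHom_assoc, ih]
    simp only [liftPow, MonoidalCategory.tensorHom_def, comp_whiskerRight,
      MonoidalCategory.whiskerLeft_comp, Category.assoc, ← whisker_exchange_assoc,
      MonObj.mul_assoc]
    simp only [whisker_exchange_assoc (powSucc V n).hom, whisker_exchange_assoc f μ[A.X]]
    simp

/-- The extension of `f : V ⟶ A` to an algebra morphism `T^⊗ V ⟶ A`. -/
noncomputable def lift {V : M} {A : Mon M} (f : V ⟶ A.X) : tensorAlg V ⟶ A :=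
  Mon.Hom.mk' (M := tensorAlg V) (N := A) (descT (liftPow A f))
    (by
      change unitT V ≫ _ = _
      rw [unitT, Category.assoc, incl_descT, liftPow, Iso.inv_hom_id_assoc])
    (by
      change mulT V ≫ _ = _
      refine hom_ext_L fun n => ?_
      rw [← Category.assoc, incl_mulT, concatT_lift]
      change _ = incl V n ▷ tensorAlgObj V ≫ (descT (liftPow A f) ⊗ₘ descT (liftPow A f)) ≫ μ[A.X]
      rw [whiskerRight_comp_tensorHom_assoc, incl_descT])

lemma ι₁_lift {V : M} {A : Mon M} (f : V ⟶ A.X) : ι₁ V ≫ (lift f).hom = f := by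
  change ((ρ_ V).inv ≫ V ◁ (powZero V).inv ≫ (powSucc V 0).inv ≫ incl V 1) ≫
    descT (liftPow A f) = f
  simp only [Category.assoc, incl_descT, liftPow, Iso.inv_hom_id_assoc]
  simp [whiskerLeft_comp_tensorHom_assoc]

lemma ι₁_mulT (V : M) : ι₁ V ▷ tensorAlgObj V ≫ mulT V = consT V := by
  have h : (ρ_ V).inv ▷ tensorAlgObj V ≫ (α_ V (𝟙_ M) (tensorAlgObj V)).hom ≫
      V ◁ (λ_ (tensorAlgObj V)).hom = 𝟙 _ := by simp
  simp only [ι₁, comp_whiskerRight, Category.assoc, incl_mulT, concatT,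
    inv_hom_whiskerRight_assoc, associator_naturality_middle_assoc]
  have h' : V ◁ (powZero V).inv ▷ tensorAlgObj V ≫ V ◁ (powZero V).hom ▷ tensorAlgObj V = 𝟙 _ := by
    rw [← MonoidalCategory.whiskerLeft_comp, inv_hom_whiskerRight,
      MonoidalCategory.whiskerLeft_id]
  rw [MonoidalCategory.whiskerLeft_comp_assoc, reassoc_of% h']
  rw [reassoc_of% h]

/-- Algebra morphisms out of `T^⊗ V` are determined by their restriction to `V`. -/
lemma tensorAlg_hom_ext {V : M} {A : Mon M} {f g : tensorAlg V ⟶ A}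
    (h : ι₁ V ≫ f.hom = ι₁ V ≫ g.hom) : f = g := by
  have key : ∀ k : tensorAlg V ⟶ A,
      consT V ≫ k.hom = (ι₁ V ≫ k.hom ⊗ₘ k.hom) ≫ μ[A.X] := fun k => by
    rw [← ι₁_mulT, Category.assoc]
    have : mulT V ≫ k.hom = (k.hom ⊗ₘ k.hom) ≫ μ[A.X] := IsMonHom.mul_hom k.hom
    rw [this]
    exact whiskerRight_comp_tensorHom_assoc _ _ _ _
  apply Mon.Hom.ext
  refine hom_ext_T fun n => ?_
  induction n with
  | zero =>
    rw [← cancel_epi (powZero V).inv, ← Category.assoc, ← Category.assoc]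
    exact (IsMonHom.one_hom f.hom).trans (IsMonHom.one_hom g.hom).symm
  | succ n ih =>
    rw [← cancel_epi (powSucc V n).inv, ← Category.assoc, ← Category.assoc, ← incl_consT,
      Category.assoc, Category.assoc, key f, key g, whiskerLeft_comp_tensorHom_assoc,
      whiskerLeft_comp_tensorHom_assoc, h, ih]

/-! ### Quotient algebras -/

section Quotient

variable {X : M} {A : Mon M} (q₁ q₂ : X ⟶ A.X)

instance whiskerLeft_epi {Y Z W : M} (f : Y ⟶ Z) [Epi f] : Epi (W ◁ f) := by
  have : (tensorLeft W).IsLeftAdjoint := (ihom.adjunction W).isLeftAdjoint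
  exact (inferInstance : Epi ((tensorLeft W).map f))

instance whiskerRight_epi {Y Z W : M} (f : Y ⟶ Z) [Epi f] : Epi (f ▷ W) := by
  have h : f ▷ W = (β_ Y W).hom ≫ W ◁ f ≫ (β_ W Z).hom := by simp
  rw [h]
  infer_instance

/-- The morphism `a ⊗ x ⊗ b ↦ a q(x) b`. -/
def sandwich (q : X ⟶ A.X) : A.X ⊗ (X ⊗ A.X) ⟶ A.X := A.X ◁ (q ▷ A.X ≫ μ[A.X]) ≫ μ[A.X]

lemma whiskerLeft_sandwich (q : X ⟶ A.X) : A.X ◁ sandwich q ≫ μ[A.X] =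
    (α_ A.X A.X (X ⊗ A.X)).inv ≫ μ[A.X] ▷ (X ⊗ A.X) ≫ sandwich q := by
  simp only [sandwich, ← whisker_exchange_assoc, MonObj.mul_assoc]
  simp

lemma sandwich_whiskerRight (q : X ⟶ A.X) : sandwich q ▷ A.X ≫ μ[A.X] =
    (α_ A.X (X ⊗ A.X) A.X).hom ≫ A.X ◁ ((α_ X A.X A.X).hom ≫ X ◁ μ[A.X]) ≫ sandwich q := by
  have h : (q ▷ A.X ≫ μ[A.X]) ▷ A.X ≫ μ[A.X] =
      (α_ X A.X A.X).hom ≫ X ◁ μ[A.X] ≫ q ▷ A.X ≫ μ[A.X] := by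
    rw [comp_whiskerRight_assoc, MonObj.mul_assoc, associator_naturality_left_assoc,
      whisker_exchange_assoc]
  rw [sandwich, comp_whiskerRight_assoc, MonObj.mul_assoc, associator_naturality_middle_assoc,
    ← MonoidalCategory.whiskerLeft_comp_assoc, h]
  simp

/-- The underlying object of the quotient of `A` by the two-sided ideal of relations
`q₁ = q₂`. -/
noncomputable def quotObj : M := coequalizer (sandwich q₁) (sandwich q₂)

/-- The projection to the quotient. -/
noncomputable def proj : A.X ⟶ quotObj q₁ q₂ := coequalizer.π _ _

instance : Epi (proj q₁ q₂) := by
  exact inferInstanceAs (Epi (coequalizer.π (sandwich q₁) (sandwich q₂)))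

lemma sandwich_proj : sandwich q₁ ≫ proj q₁ q₂ = sandwich q₂ ≫ proj q₁ q₂ :=
  coequalizer.condition _ _

lemma exists_desc {Z : M} (k : A.X ⟶ Z) (hk : sandwich q₁ ≫ k = sandwich q₂ ≫ k) :
    ∃ l : quotObj q₁ q₂ ⟶ Z, proj q₁ q₂ ≫ l = k :=
  ⟨coequalizer.desc k hk, coequalizer.π_desc k hk⟩

lemma proj_desc_left {Y Z : M} (k : Y ⊗ A.X ⟶ Z) (hk : Y ◁ sandwich q₁ ≫ k = Y ◁ sandwich q₂ ≫ k) :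
    ∃ l : Y ⊗ quotObj q₁ q₂ ⟶ Z, Y ◁ proj q₁ q₂ ≫ l = k := by
  have hk' : sandwich q₁ ≫ MonoidalClosed.curry k = sandwich q₂ ≫ MonoidalClosed.curry k := by
    rw [← MonoidalClosed.curry_natural_left, hk, MonoidalClosed.curry_natural_left]
  obtain ⟨l, hl⟩ := exists_desc q₁ q₂ _ hk'
  refine ⟨MonoidalClosed.uncurry l, ?_⟩
  rw [← MonoidalClosed.uncurry_natural_left, hl, MonoidalClosed.uncurry_curry]

lemma proj_desc_right {Y Z : M} (k : A.X ⊗ Y ⟶ Z)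
    (hk : sandwich q₁ ▷ Y ≫ k = sandwich q₂ ▷ Y ≫ k) :
    ∃ l : quotObj q₁ q₂ ⊗ Y ⟶ Z, proj q₁ q₂ ▷ Y ≫ l = k := by
  obtain ⟨l, hl⟩ := proj_desc_left q₁ q₂ ((β_ Y A.X).hom ≫ k) (by
    simp only [BraidedCategory.braiding_naturality_right_assoc, hk])
  refine ⟨(β_ _ _).hom ≫ l, ?_⟩
  rw [BraidedCategory.braiding_naturality_left_assoc, hl, SymmetricCategory.symmetry_assoc]

lemma exists_quotMul : ∃ m : quotObj q₁ q₂ ⊗ quotObj q₁ q₂ ⟶ quotObj q₁ q₂,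
    (proj q₁ q₂ ⊗ₘ proj q₁ q₂) ≫ m = μ[A.X] ≫ proj q₁ q₂ := by
  obtain ⟨l, hl⟩ := proj_desc_left q₁ q₂ (μ[A.X] ≫ proj q₁ q₂) (by
    rw [← Category.assoc, ← Category.assoc, whiskerLeft_sandwich, whiskerLeft_sandwich]
    simp only [Category.assoc, sandwich_proj q₁ q₂])
  obtain ⟨m, hm⟩ := proj_desc_right q₁ q₂ l (by
    rw [← cancel_epi (_ ◁ proj q₁ q₂), whisker_exchange_assoc, whisker_exchange_assoc, hl,
      ← Category.assoc, ← Category.assoc, sandwich_whiskerRight, sandwich_whiskerRight]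
    simp only [Category.assoc, sandwich_proj q₁ q₂])
  refine ⟨m, ?_⟩
  rw [MonoidalCategory.tensorHom_def', Category.assoc, hm, hl]

/-- The multiplication of the quotient. -/
noncomputable def quotMul : quotObj q₁ q₂ ⊗ quotObj q₁ q₂ ⟶ quotObj q₁ q₂ :=
  (exists_quotMul q₁ q₂).choose

lemma proj_quotMul : (proj q₁ q₂ ⊗ₘ proj q₁ q₂) ≫ quotMul q₁ q₂ = μ[A.X] ≫ proj q₁ q₂ :=
  (exists_quotMul q₁ q₂).choose_spec

noncomputable instance : MonObj (quotObj q₁ q₂) where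
  one := η[A.X] ≫ proj q₁ q₂
  mul := quotMul q₁ q₂
  one_mul := by
    rw [← cancel_epi (_ ◁ proj q₁ q₂), comp_whiskerRight_assoc, whisker_exchange_assoc,
      ← MonoidalCategory.tensorHom_def'_assoc, proj_quotMul]
    simp
  mul_one := by
    rw [← cancel_epi (proj q₁ q₂ ▷ _), MonoidalCategory.whiskerLeft_comp_assoc,
      ← whisker_exchange_assoc, ← MonoidalCategory.tensorHom_def_assoc, proj_quotMul]
    simp
  mul_assoc := by
    have : Epi ((proj q₁ q₂ ⊗ₘ proj q₁ q₂) ⊗ₘ proj q₁ q₂) := by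
      simp only [MonoidalCategory.tensorHom_def]
      infer_instance
    rw [← cancel_epi ((proj q₁ q₂ ⊗ₘ proj q₁ q₂) ⊗ₘ proj q₁ q₂)]
    rw [tensorHom_comp_whiskerRight_assoc, proj_quotMul, associator_naturality_assoc,
      tensorHom_comp_whiskerLeft_assoc, proj_quotMul,
      ← whiskerRight_comp_tensorHom_assoc, ← whiskerLeft_comp_tensorHom_assoc, proj_quotMul]
    simp

/-- The coequalizer of two algebra morphisms out of a tensor algebra exists. -/
instance hasCoequalizer_lift : HasCoequalizer (lift q₁) (lift q₂) := by
  let Q : Mon M := ⟨quotObj q₁ q₂⟩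
  let p : A ⟶ Q := Mon.Hom.mk' (M := A) (N := Q) (proj q₁ q₂) rfl (proj_quotMul q₁ q₂).symm
  have key : ∀ {B : Mon M} (k : A ⟶ B),
      lift q₁ ≫ k = lift q₂ ≫ k ↔ q₁ ≫ k.hom = q₂ ≫ k.hom := by
    intro B k
    have e : ∀ q : X ⟶ A.X, ι₁ X ≫ (lift q ≫ k).hom = q ≫ k.hom := fun q => by
      rw [Mon.comp_hom', ← Category.assoc, ι₁_lift]
    rw [← e q₁, ← e q₂]
    exact ⟨fun h => by rw [h], tensorAlg_hom_ext⟩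
  have e1 : ∀ {B : Mon M} (k : A ⟶ B) (q : X ⟶ A.X), sandwich q ≫ k.hom =
      (k.hom ⊗ₘ ((q ≫ k.hom) ⊗ₘ k.hom) ≫ μ[B.X]) ≫ μ[B.X] := by
    intro B k q
    have h : (q ▷ A.X ≫ μ[A.X]) ≫ k.hom = ((q ≫ k.hom) ⊗ₘ k.hom) ≫ μ[B.X] := by
      rw [Category.assoc, IsMonHom.mul_hom, whiskerRight_comp_tensorHom_assoc]
    rw [sandwich, Category.assoc, IsMonHom.mul_hom, whiskerLeft_comp_tensorHom_assoc, h]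
  have e2 : ∀ q : X ⟶ A.X,
      ((λ_ X).inv ≫ (η[A.X] ⊗ₘ ((ρ_ X).inv ≫ X ◁ η[A.X]))) ≫ sandwich q = q := by
    intro q
    have h : ((ρ_ X).inv ≫ X ◁ η[A.X]) ≫ q ▷ A.X ≫ μ[A.X] = q := by
      rw [Category.assoc, whisker_exchange_assoc, MonObj.mul_one, rightUnitor_naturality,
        Iso.inv_hom_id_assoc]
    rw [sandwich, Category.assoc, tensorHom_comp_whiskerLeft_assoc, h, MonObj.one_mul_hom,
      Iso.inv_hom_id_assoc]
  have w : lift q₁ ≫ p = lift q₂ ≫ p := by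
    rw [key]
    change q₁ ≫ proj q₁ q₂ = q₂ ≫ proj q₁ q₂
    calc q₁ ≫ proj q₁ q₂ = (_ ≫ sandwich q₁) ≫ proj q₁ q₂ := by rw [e2]
      _ = (_ ≫ sandwich q₂) ≫ proj q₁ q₂ := by
        rw [Category.assoc, sandwich_proj, ← Category.assoc]
      _ = _ := by rw [e2]
  refine HasColimit.mk ⟨Cofork.ofπ p w, Cofork.IsColimit.mk' _ fun s => ?_⟩
  have hs := (key s.π).1 s.condition
  have hs' : sandwich q₁ ≫ s.π.hom = sandwich q₂ ≫ s.π.hom := by rw [e1, e1, hs]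
  have hl := (exists_desc q₁ q₂ _ hs').choose_spec
  set l := (exists_desc q₁ q₂ _ hs').choose
  refine ⟨Mon.Hom.mk' (M := Q) l ?_ ?_, ?_, ?_⟩
  · change (η[A.X] ≫ proj q₁ q₂) ≫ l = _
    rw [Category.assoc, hl]
    exact IsMonHom.one_hom _
  · have : Epi (proj q₁ q₂ ⊗ₘ proj q₁ q₂) := by
      simp only [MonoidalCategory.tensorHom_def]
      infer_instance
    rw [← cancel_epi (proj q₁ q₂ ⊗ₘ proj q₁ q₂)]
    change _ ≫ quotMul q₁ q₂ ≫ l = _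
    rw [← Category.assoc, proj_quotMul, Category.assoc, hl, tensorHom_comp_tensorHom_assoc, hl]
    exact IsMonHom.mul_hom _
  · exact Mon.Hom.ext hl
  · intro m hm
    apply Mon.Hom.ext
    rw [← cancel_epi (proj q₁ q₂)]
    exact (congrArg Mon.Hom.hom hm).trans hl.symm

end Quotient

end TensorAlgebra

/-! ### Unital Lie algebras -/

section Algebras

variable (M : Type u) [Category.{v} M] [MonoidalCategory M] [SymmetricCategory M]

variable {M} in
/-- The cyclic permutation `x₁ ⊗ (x₂ ⊗ x₃) ↦ x₂ ⊗ (x₃ ⊗ x₁)`. -/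
def cyc (X : M) : X ⊗ (X ⊗ X) ⟶ X ⊗ (X ⊗ X) :=
  (β_ X (X ⊗ X)).hom ≫ (α_ X X X).hom

section

variable {M}

lemma cyc_eq (X : M) :
    cyc X = ((α_ X X X).inv ≫ (β_ X X).hom ▷ X ≫ (α_ X X X).hom) ≫ X ◁ (β_ X X).hom := by
  simp [cyc, BraidedCategory.braiding_tensor_right_hom]

lemma swap_swap (X : M) : X ◁ (β_ X X).hom ≫ X ◁ (β_ X X).hom = 𝟙 _ := by
  rw [← MonoidalCategory.whiskerLeft_comp, SymmetricCategory.symmetry,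
    MonoidalCategory.whiskerLeft_id]

lemma swap_swap' (X : M) :
    ((α_ X X X).inv ≫ (β_ X X).hom ▷ X ≫ (α_ X X X).hom) ≫
      ((α_ X X X).inv ≫ (β_ X X).hom ▷ X ≫ (α_ X X X).hom) = 𝟙 _ := by
  simp only [Category.assoc, Iso.hom_inv_id_assoc]
  rw [← comp_whiskerRight_assoc, SymmetricCategory.symmetry]
  simp

lemma cyc_swap_cyc (X : M) : cyc X ≫ X ◁ (β_ X X).hom ≫ cyc X = X ◁ (β_ X X).hom := by
  have h1 := swap_swap X
  have h2 := swap_swap' X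
  rw [cyc_eq]
  generalize X ◁ (β_ X X).hom = t at *
  generalize (α_ X X X).inv ≫ (β_ X X).hom ▷ X ≫ (α_ X X X).hom = a at *
  simp only [Category.assoc]
  rw [← Category.assoc t t, h1, Category.id_comp, ← Category.assoc a a, h2, Category.id_comp]

lemma cyc_cyc_cyc (X : M) : cyc X ≫ cyc X ≫ cyc X = 𝟙 _ := by
  have h1 := swap_swap X
  have h2 := swap_swap' X
  have h3 := BraidedCategory.yang_baxter X X X
  have h4 : ((α_ X X X).inv ≫ (β_ X X).hom ▷ X ≫ (α_ X X X).hom) ≫ X ◁ (β_ X X).hom ≫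
      ((α_ X X X).inv ≫ (β_ X X).hom ▷ X ≫ (α_ X X X).hom) = X ◁ (β_ X X).hom ≫
      ((α_ X X X).inv ≫ (β_ X X).hom ▷ X ≫ (α_ X X X).hom) ≫ X ◁ (β_ X X).hom := by
    simpa only [Category.assoc] using h3
  rw [cyc_eq]
  generalize X ◁ (β_ X X).hom = t at *
  generalize (α_ X X X).inv ≫ (β_ X X).hom ▷ X ≫ (α_ X X X).hom = a at *
  calc (a ≫ t) ≫ (a ≫ t) ≫ a ≫ t = (a ≫ t ≫ a) ≫ t ≫ a ≫ t := by simp only [Category.assoc]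
    _ = t ≫ a ≫ (t ≫ t) ≫ a ≫ t := by rw [h4]; simp only [Category.assoc]
    _ = t ≫ (a ≫ a) ≫ t := by rw [h1]; simp only [Category.assoc, Category.id_comp]
    _ = 𝟙 _ := by rw [h2, Category.id_comp, h1]

end

variable [Preadditive M]

/-- A unital Lie algebra in `M`: an algebra over the unital Lie operad, i.e. an object with a
binary bracket and a unit (the two generators of the operad) which satisfy antisymmetry, the
Jacobi identity and `[x, 1] = 0` (its relations). -/
structure ULieAlg where
  /-- The underlying object. -/
  X : M
  /-- The Lie bracket. -/
  bracket : X ⊗ X ⟶ X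
  /-- The unit. -/
  unit : 𝟙_ M ⟶ X
  antisymm : bracket = -((β_ X X).hom ≫ bracket)
  jacobi : X ◁ bracket ≫ bracket + cyc X ≫ X ◁ bracket ≫ bracket +
    cyc X ≫ cyc X ≫ X ◁ bracket ≫ bracket = 0
  bracket_unit : X ◁ unit ≫ bracket = 0

namespace ULieAlg

variable {M}

/-- Morphisms of unital Lie algebras. -/
@[ext]
structure Hom (V W : ULieAlg M) where
  /-- The underlying morphism. -/
  hom : V.X ⟶ W.X
  bracket_hom : V.bracket ≫ hom = (hom ⊗ₘ hom) ≫ W.bracket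
  unit_hom : V.unit ≫ hom = W.unit

instance : Category (ULieAlg M) where
  Hom V W := Hom V W
  id V := ⟨𝟙 V.X, by simp, by simp⟩
  comp f g := ⟨f.hom ≫ g.hom,
    by rw [← Category.assoc, f.bracket_hom, Category.assoc, g.bracket_hom,
      ← tensorHom_comp_tensorHom, Category.assoc],
    by rw [← Category.assoc, f.unit_hom, g.unit_hom]⟩
  id_comp f := Hom.ext (Category.id_comp f.hom)
  comp_id f := Hom.ext (Category.comp_id f.hom)
  assoc f g h := Hom.ext (Category.assoc f.hom g.hom h.hom)

@[ext]
lemma hom_ext {V W : ULieAlg M} {f g : V ⟶ W} (h : f.hom = g.hom) : f = g := Hom.ext h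

@[simp] lemma id_hom (V : ULieAlg M) : Hom.hom (𝟙 V) = 𝟙 V.X := rfl

@[simp] lemma comp_hom {V W Z : ULieAlg M} (f : V ⟶ W) (g : W ⟶ Z) :
    Hom.hom (f ≫ g) = f.hom ≫ g.hom := rfl

variable (M) in
/-- The forgetful functor to `M`. -/
@[simps]
def forget : ULieAlg M ⥤ M where
  obj V := V.X
  map f := f.hom

end ULieAlg

/-! ### The commutator -/

variable {M}

/-- The commutator `μ - μᵒᵖ` of a monoid object. -/
def commutator (A : M) [MonObj A] : A ⊗ A ⟶ A := μ[A] - (β_ A A).hom ≫ μ[A]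

lemma commutator_jacobi [MonoidalPreadditive M] (A : M) [MonObj A] :
    A ◁ commutator A ≫ commutator A + cyc A ≫ A ◁ commutator A ≫ commutator A +
      cyc A ≫ cyc A ≫ A ◁ commutator A ≫ commutator A = 0 := by
  have e1 : A ◁ μ[A] ≫ (β_ A A).hom ≫ μ[A] = cyc A ≫ A ◁ μ[A] ≫ μ[A] := by
    rw [BraidedCategory.braiding_naturality_right_assoc, MonObj.mul_assoc, cyc, Category.assoc]
  have e0 : A ◁ commutator A = A ◁ μ[A] - A ◁ (β_ A A).hom ≫ A ◁ μ[A] := by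
    rw [← MonoidalCategory.whiskerLeft_comp]
    exact (tensorLeft A).map_sub
  have e2 : A ◁ commutator A ≫ commutator A =
      (𝟙 _ - A ◁ (β_ A A).hom - cyc A + A ◁ (β_ A A).hom ≫ cyc A) ≫ A ◁ μ[A] ≫ μ[A] := by
    rw [e0]
    simp only [commutator, Preadditive.sub_comp, Preadditive.comp_sub, Preadditive.add_comp,
      Category.assoc, e1, Category.id_comp]
    abel
  have h1 := cyc_cyc_cyc A
  have h2 := cyc_swap_cyc A
  rw [e2]
  generalize A ◁ μ[A] ≫ μ[A] = m at *
  generalize A ◁ (β_ A A).hom = t at *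
  generalize cyc A = c at *
  have h3 : ∀ f : A ⊗ A ⊗ A ⟶ A ⊗ A ⊗ A, c ≫ c ≫ c ≫ f = f := fun f => by
    simpa only [Category.assoc, Category.id_comp] using congrArg (· ≫ f) h1
  have h4 : t ≫ c = c ≫ c ≫ t := by
    calc t ≫ c = (c ≫ c ≫ c) ≫ t ≫ c := by rw [h1, Category.id_comp]
      _ = c ≫ c ≫ (c ≫ t ≫ c) := by simp only [Category.assoc]
      _ = _ := by rw [h2]
  rw [← Category.assoc c, ← Category.assoc c, ← Category.assoc c, ← Preadditive.add_comp,
    ← Preadditive.add_comp]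
  convert zero_comp
  simp only [Preadditive.comp_add, Preadditive.comp_sub, Category.comp_id, Category.assoc, h1, h3,
    h4]
  abel

/-- The tensor product of a closed symmetric monoidal additive category is biadditive. -/
lemma monoidalPreadditive [MonoidalClosed M] [HasColimits M] : MonoidalPreadditive M := by
  have : HasBinaryBiproducts M := HasBinaryBiproducts.of_hasBinaryCoproducts
  have key : ∀ X : M, (tensorLeft X).Additive := fun X => by
    have : (tensorLeft X).IsLeftAdjoint := (ihom.adjunction X).isLeftAdjoint
    have : (tensorLeft X).PreservesZeroMorphisms := inferInstance
    have := preservesBinaryBiproducts_of_preservesBinaryCoproducts (tensorLeft X)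
    exact Functor.additive_of_preservesBinaryBiproducts _
  have key' : ∀ X : M, (tensorRight X).Additive := fun X =>
    (Functor.additive_iff_of_iso (BraidedCategory.tensorLeftIsoTensorRight X)).1 (key X)
  exact
    { whiskerLeft_zero := fun {X _ _} => (tensorLeft X).map_zero _ _
      zero_whiskerRight := fun {X _ _} => (tensorRight X).map_zero _ _
      whiskerLeft_add := fun {X _ _} _ _ => (tensorLeft X).map_add
      add_whiskerRight := fun {X _ _} _ _ => (tensorRight X).map_add }

variable [MonoidalClosed M] [HasColimits M]

variable (M) in
/-- The functor `φ^* : Alg_As ⥤ Alg_uLie` induced by the map `φ` from the unital Lie operad to the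
associative operad with `φ(η) = η` and `φ([·,·]) = μ - μᵒᵖ`: it sends an associative and unital
algebra `(A, μ, η)` to the unital Lie algebra `(A, μ - μᵒᵖ, η)`. -/
@[simps]
def phiStar : Mon M ⥤ ULieAlg M where
  obj A :=
    { X := A.X
      bracket := commutator A.X
      unit := η[A.X]
      antisymm := by simp [commutator]
      jacobi := by
        have := monoidalPreadditive (M := M)
        exact commutator_jacobi A.X
      bracket_unit := by simp [commutator] }
  map f :=
    { hom := f.hom
      bracket_hom := by simp [commutator]
      unit_hom := by simp }

/-! ### The unital universal enveloping algebra -/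

namespace ULieAlg

/-- `q₁ = (μ_⊗ - μ_⊗ᵒᵖ) (ι₁ ⊗ ι₁) : V ⊗ V ⟶ T^⊗ V`. -/
noncomputable def q₁ (V : ULieAlg M) : V.X ⊗ V.X ⟶ (tensorAlg V.X).X :=
  (ι₁ V.X ⊗ₘ ι₁ V.X) ≫ commutator (tensorAlg V.X).X

/-- `q₂ = ι₁ [·,·] : V ⊗ V ⟶ T^⊗ V`. -/
noncomputable def q₂ (V : ULieAlg M) : V.X ⊗ V.X ⟶ (tensorAlg V.X).X :=
  V.bracket ≫ ι₁ V.X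

/-- The universal enveloping algebra `U^⊗ V`: the coequalizer of
`q₁, q₂ : T^⊗ (V ⊗ V) ⇉ T^⊗ V` in the category of associative and unital algebras. -/
noncomputable def envAlg (V : ULieAlg M) : Mon M := coequalizer (lift V.q₁) (lift V.q₂)

/-- The projection `π : T^⊗ V ⟶ U^⊗ V`. -/
noncomputable def π (V : ULieAlg M) : tensorAlg V.X ⟶ envAlg V :=
  coequalizer.π (lift V.q₁) (lift V.q₂)

/-- `s₁ = π ι₁ η : 𝟙 ⟶ U^⊗ V`. -/
noncomputable def s₁ (V : ULieAlg M) : 𝟙_ M ⟶ (envAlg V).X := V.unit ≫ ι₁ V.X ≫ V.π.hom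

/-- `s₂ = π η_⊗ : 𝟙 ⟶ U^⊗ V`. -/
noncomputable def s₂ (V : ULieAlg M) : 𝟙_ M ⟶ (envAlg V).X := η[(tensorAlg V.X).X] ≫ V.π.hom

/-- The unital universal enveloping algebra `φ_!(V)`: the coequalizer of
`s₁, s₂ : T^⊗ 𝟙 ⇉ U^⊗ V` in the category of associative and unital algebras. -/
noncomputable def unitalEnvAlg (V : ULieAlg M) : Mon M := coequalizer (lift V.s₁) (lift V.s₂)

/-- The projection `π' : U^⊗ V ⟶ φ_!(V)`. -/
noncomputable def piUnital (V : ULieAlg M) : envAlg V ⟶ unitalEnvAlg V :=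
  coequalizer.π (lift V.s₁) (lift V.s₂)

end ULieAlg

lemma lift_comp {X : M} {A B : Mon M} (f : X ⟶ A.X) (k : A ⟶ B) :
    lift f ≫ k = lift (f ≫ k.hom) := by
  apply tensorAlg_hom_ext
  rw [Mon.comp_hom', ← Category.assoc, ι₁_lift, ι₁_lift]

lemma ι₁_lift_comp {X : M} {A B : Mon M} (f : X ⟶ A.X) (k : A ⟶ B) :
    ι₁ X ≫ (lift f ≫ k).hom = f ≫ k.hom := by
  rw [lift_comp, ι₁_lift]

lemma commutator_hom {A B : Mon M} (k : A ⟶ B) :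
    commutator A.X ≫ k.hom = (k.hom ⊗ₘ k.hom) ≫ commutator B.X := by
  simp [commutator]

/-- `T^⊗` on morphisms. -/
noncomputable def tensorAlgMap {V W : M} (f : V ⟶ W) : tensorAlg V ⟶ tensorAlg W :=
  lift (f ≫ ι₁ W)

namespace ULieAlg

lemma q_condition (V : ULieAlg M) : V.q₁ ≫ V.π.hom = V.q₂ ≫ V.π.hom := by
  rw [← ι₁_lift_comp V.q₁, ← ι₁_lift_comp V.q₂]
  exact congrArg (fun k => ι₁ _ ≫ Mon.Hom.hom k) (coequalizer.condition (lift V.q₁) (lift V.q₂))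

lemma s_condition (V : ULieAlg M) : V.s₁ ≫ V.piUnital.hom = V.s₂ ≫ V.piUnital.hom := by
  rw [← ι₁_lift_comp V.s₁, ← ι₁_lift_comp V.s₂]
  exact congrArg (fun k => ι₁ _ ≫ Mon.Hom.hom k) (coequalizer.condition (lift V.s₁) (lift V.s₂))

/-- `U^⊗` on morphisms. -/
noncomputable def envAlgMap {V W : ULieAlg M} (f : V ⟶ W) : envAlg V ⟶ envAlg W :=
  coequalizer.desc (tensorAlgMap f.hom ≫ W.π) (by
    have h : ι₁ V.X ≫ (tensorAlgMap f.hom).hom = f.hom ≫ ι₁ W.X := ι₁_lift _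
    rw [lift_comp, lift_comp]
    congr 1
    have h1 : V.q₁ ≫ (tensorAlgMap f.hom).hom = (f.hom ⊗ₘ f.hom) ≫ W.q₁ := by
      rw [q₁, q₁, Category.assoc, commutator_hom, tensorHom_comp_tensorHom_assoc, h,
        tensorHom_comp_tensorHom_assoc]
    have h2 : V.q₂ ≫ (tensorAlgMap f.hom).hom = (f.hom ⊗ₘ f.hom) ≫ W.q₂ := by
      rw [q₂, q₂, Category.assoc, h, ← Category.assoc, ← Category.assoc, f.bracket_hom]
    rw [Mon.comp_hom', ← Category.assoc, ← Category.assoc, h1, h2, Category.assoc, Category.assoc,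
      q_condition])

lemma π_envAlgMap {V W : ULieAlg M} (f : V ⟶ W) :
    V.π ≫ envAlgMap f = tensorAlgMap f.hom ≫ W.π :=
  coequalizer.π_desc _ _

/-- `φ_!` on morphisms. -/
noncomputable def unitalEnvAlgMap {V W : ULieAlg M} (f : V ⟶ W) :
    unitalEnvAlg V ⟶ unitalEnvAlg W :=
  coequalizer.desc (envAlgMap f ≫ W.piUnital) (by
    have h : ι₁ V.X ≫ (tensorAlgMap f.hom).hom = f.hom ≫ ι₁ W.X := ι₁_lift _
    have h' : V.π.hom ≫ (envAlgMap f).hom = (tensorAlgMap f.hom).hom ≫ W.π.hom :=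
      congrArg Mon.Hom.hom (π_envAlgMap f)
    rw [lift_comp, lift_comp]
    congr 1
    have h1 : V.s₁ ≫ (envAlgMap f).hom = W.s₁ := by
      rw [s₁, s₁, Category.assoc, Category.assoc, h', ← Category.assoc (ι₁ V.X), h,
        ← f.unit_hom, Category.assoc, Category.assoc]
    have h2 : V.s₂ ≫ (envAlgMap f).hom = W.s₂ := by
      rw [s₂, s₂, Category.assoc, h', ← Category.assoc, IsMonHom.one_hom]
    rw [Mon.comp_hom', ← Category.assoc, ← Category.assoc, h1, h2, s_condition])

lemma piUnital_unitalEnvAlgMap {V W : ULieAlg M} (f : V ⟶ W) :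
    V.piUnital ≫ unitalEnvAlgMap f = envAlgMap f ≫ W.piUnital :=
  coequalizer.π_desc _ _

/-- Algebra morphisms out of `φ_!(V)` are determined by their restriction to `V`. -/
lemma unitalEnvAlg_hom_ext {V : ULieAlg M} {A : Mon M} {f g : unitalEnvAlg V ⟶ A}
    (h : ι₁ V.X ≫ (V.π ≫ V.piUnital ≫ f).hom = ι₁ V.X ≫ (V.π ≫ V.piUnital ≫ g).hom) : f = g :=
  coequalizer.hom_ext (coequalizer.hom_ext (tensorAlg_hom_ext h))

lemma ι₁_unitalEnvAlgMap {V W : ULieAlg M} (f : V ⟶ W) :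
    ι₁ V.X ≫ (V.π ≫ V.piUnital ≫ unitalEnvAlgMap f).hom = f.hom ≫ ι₁ W.X ≫ (W.π ≫ W.piUnital).hom := by
  rw [piUnital_unitalEnvAlgMap, ← Category.assoc V.π, π_envAlgMap, Category.assoc, tensorAlgMap,
    ι₁_lift_comp, Category.assoc]

end ULieAlg

variable (M) in
/-- The unital universal enveloping algebra functor `φ_! : Alg_uLie ⥤ Alg_As`. -/
@[simps]
noncomputable def phiShriek : ULieAlg M ⥤ Mon M where
  obj V := V.unitalEnvAlg
  map f := ULieAlg.unitalEnvAlgMap f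
  map_id V := by
    apply ULieAlg.unitalEnvAlg_hom_ext
    rw [ULieAlg.ι₁_unitalEnvAlgMap]
    simp
  map_comp {V W Z} f g := by
    apply ULieAlg.unitalEnvAlg_hom_ext
    have h := ULieAlg.ι₁_unitalEnvAlgMap f
    have h' := ULieAlg.ι₁_unitalEnvAlgMap g
    simp only [Mon.comp_hom'] at h h'
    rw [ULieAlg.ι₁_unitalEnvAlgMap]
    simp only [Mon.comp_hom', ULieAlg.comp_hom, Category.assoc]
    simp only [← Category.assoc] at h h' ⊢
    rw [h]
    simp only [Category.assoc] at h h' ⊢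
    rw [h']

/-! ### Linear and quantum field theories -/

section FieldTheories

variable (M)
variable {C : Type u₁} [Category.{v₁} C] (O : Orthogonality C)

/-- Quantum field theories: functors `C ⥤ Alg_As` such that
`[A(f₁)(-), A(f₂)(-)] = 0` for all `f₁ ⊥ f₂`. -/
abbrev isQFT : ObjectProperty (C ⥤ Mon M) :=
  isFieldTheory (Mon.forget M) (fun A => commutator A.X) (fun _ => 0) O

/-- Linear field theories: functors `C ⥤ Alg_uLie` such that
`[B(f₁)(-), B(f₂)(-)] = 0` for all `f₁ ⊥ f₂`. -/
abbrev isLFT : ObjectProperty (C ⥤ ULieAlg M) :=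
  isFieldTheory (ULieAlg.forget M) (fun V => V.bracket) (fun _ => 0) O

/-- The category `QFT(C, ⊥)`. -/
abbrev QFT := (isQFT M O).FullSubcategory

/-- The category `LFT(C, ⊥)`. -/
abbrev LFT := (isLFT M O).FullSubcategory

/-- The functor `U_lin : QFT(C, ⊥) ⥤ LFT(C, ⊥)`, i.e. the restriction of
`(φ^*)_* = φ^* ∘ (-)` to field theories. -/
def Ulin : QFT M O ⥤ LFT M O :=
  (isLFT M O).lift ((isQFT M O).ι ⋙ (Functor.whiskeringRight C _ _).obj (phiStar M))
    (fun A => A.property)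

variable {M O} in
/-- Provided that `B ⋙ φ_!` is a quantum field theory for all linear field theories `B`, the
restriction `LFT(C, ⊥) ⥤ QFT(C, ⊥)` of `(φ_!)_* = φ_! ∘ (-)` to field theories. -/
noncomputable def phiShriekRestricted
    (h : ∀ B : C ⥤ ULieAlg M, isLFT M O B → isQFT M O (B ⋙ phiShriek M)) :
    LFT M O ⥤ QFT M O :=
  (isQFT M O).lift ((isLFT M O).ι ⋙ (Functor.whiskeringRight C _ _).obj (phiShriek M))
    (fun B => h B.obj B.property)

end FieldTheories

end Algebras

end LinearQuantization

/-!
The functor `φ_!` is left adjoint to `φ^*` by the universal properties of the tensor algebra and of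
the two coequalizers. That `φ_!` preserves `⊥`-commutativity holds for every left adjoint `F` of
`φ^*`: the centralizer of a morphism `f : Y ⟶ A` is a subalgebra `Z(f)` of `A`, so if the transpose
`V ⟶ φ^* A` of an algebra morphism `k : F V ⟶ A` commutes with `f`, it factors through `φ^* Z(f)`;
hence `k` factors through `Z(f)` and commutes with `f` as well. Applying this in both arguments
reduces the commutativity of `F g₁` and `F g₂` to that of their restrictions to the Lie algebras,
where it is the vanishing of the bracket. The adjunction of field theories is then the restriction
of `φ_! ⊣ φ^*`, applied objectwise, to full subcategories.
-/

namespace LinearQuantization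

open scoped MonObj

section Commutes

variable {M : Type u} [Category.{v} M] [MonoidalCategory M]

lemma mul_assoc_tensorHom {A X Y Z : M} [MonObj A] (f : X ⟶ A) (g : Y ⟶ A) (h : Z ⟶ A) :
    (((f ⊗ₘ g) ≫ μ[A]) ⊗ₘ h) ≫ μ[A] = (α_ X Y Z).hom ≫ (f ⊗ₘ ((g ⊗ₘ h) ≫ μ[A])) ≫ μ[A] := by
  rw [← tensorHom_comp_whiskerRight_assoc, MonObj.mul_assoc, associator_naturality_assoc,
    tensorHom_comp_whiskerLeft_assoc]

/-- The generalized elements `f` and `g` of the algebra `A` commute. -/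
def Commutes [BraidedCategory M] {A : M} [MonObj A] {Y Z : M} (f : Y ⟶ A) (g : Z ⟶ A) : Prop :=
  (f ⊗ₘ g) ≫ μ[A] = (β_ Y Z).hom ≫ (g ⊗ₘ f) ≫ μ[A]

namespace Commutes

lemma symm [SymmetricCategory M] {A Y Z : M} [MonObj A] {f : Y ⟶ A} {g : Z ⟶ A}
    (h : Commutes f g) : Commutes g f := by
  rw [Commutes, h, SymmetricCategory.symmetry_assoc]

variable [BraidedCategory M] {A W Y Z : M} [MonObj A]

lemma precomp {f : Y ⟶ A} {g : Z ⟶ A} (h : Commutes f g) (k : W ⟶ Z) : Commutes f (k ≫ g) := by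
  rw [Commutes, ← whiskerLeft_comp_tensorHom_assoc, h,
    BraidedCategory.braiding_naturality_right_assoc, whiskerRight_comp_tensorHom_assoc]

lemma one (f : Y ⟶ A) : Commutes f η[A] := by
  rw [Commutes, MonObj.mul_one_hom, MonObj.one_mul_hom, braiding_leftUnitor_assoc]

lemma mul {f : W ⟶ A} {g₁ : Y ⟶ A} {g₂ : Z ⟶ A} (h₁ : Commutes f g₁) (h₂ : Commutes f g₂) :
    Commutes f ((g₁ ⊗ₘ g₂) ≫ μ[A]) := by
  have move_past_g₁ : (f ⊗ₘ ((g₁ ⊗ₘ g₂) ≫ μ[A])) ≫ μ[A] =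
      (α_ W Y Z).inv ≫ (β_ W Y).hom ▷ Z ≫ (((g₁ ⊗ₘ f) ≫ μ[A]) ⊗ₘ g₂) ≫ μ[A] := by
    rw [whiskerRight_comp_tensorHom_assoc, ← h₁, mul_assoc_tensorHom, Iso.inv_hom_id_assoc]
  have move_past_g₂ : (g₁ ⊗ₘ ((f ⊗ₘ g₂) ≫ μ[A])) ≫ μ[A] =
      Y ◁ (β_ W Z).hom ≫ (α_ Y Z W).inv ≫ (((g₁ ⊗ₘ g₂) ≫ μ[A]) ⊗ₘ f) ≫ μ[A] := by
    rw [mul_assoc_tensorHom, Iso.inv_hom_id_assoc, whiskerLeft_comp_tensorHom_assoc, ← h₂]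
  rw [Commutes, move_past_g₁, mul_assoc_tensorHom, move_past_g₂,
    BraidedCategory.braiding_tensor_right_hom]
  simp only [Category.assoc]

end Commutes

lemma commutes_iff [SymmetricCategory M] [Preadditive M] {A Y Z : M} [MonObj A] {f : Y ⟶ A}
    {g : Z ⟶ A} : Commutes f g ↔ (f ⊗ₘ g) ≫ commutator A = 0 := by
  rw [commutator, Preadditive.comp_sub, sub_eq_zero, BraidedCategory.braiding_naturality_assoc,
    Commutes]

end Commutes

section Centralizer

variable {M : Type u} [Category.{v} M] [MonoidalCategory M] [BraidedCategory M] [MonoidalClosed M]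

lemma commutes_iff_comp_curry {A Y Z : M} [MonObj A] {f : Y ⟶ A} {g : Z ⟶ A} :
    Commutes f g ↔ g ≫ MonoidalClosed.curry (f ▷ A ≫ μ[A]) =
      g ≫ MonoidalClosed.curry ((β_ Y A).hom ≫ A ◁ f ≫ μ[A]) := by
  rw [← MonoidalClosed.curry_natural_left, ← MonoidalClosed.curry_natural_left,
    MonoidalClosed.curry_injective.eq_iff, BraidedCategory.braiding_naturality_right_assoc,
    ← MonoidalCategory.tensorHom_def'_assoc, ← MonoidalCategory.tensorHom_def_assoc, Commutes]

variable [HasEqualizers M] {A Y : M} [MonObj A] (f : Y ⟶ A)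

/-- The centralizer of a generalized element `f : Y ⟶ A` of the algebra `A`, as the equalizer of
left and right multiplication by `f`, viewed as morphisms from `A` to the internal hom from `Y` to
`A`. -/
noncomputable def centralizer : M :=
  equalizer (MonoidalClosed.curry (f ▷ A ≫ μ[A]))
    (MonoidalClosed.curry ((β_ Y A).hom ≫ A ◁ f ≫ μ[A]))

namespace centralizer

/-- The inclusion of the centralizer of `f : Y ⟶ A` into `A`. -/
noncomputable def incl : centralizer f ⟶ A := equalizer.ι _ _

instance : Mono (incl f) := inferInstanceAs (Mono (equalizer.ι _ _))

lemma commutes_incl : Commutes f (incl f) := commutes_iff_comp_curry.2 (equalizer.condition _ _)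

variable {f}

/-- The factorization through the centralizer of `f` of a generalized element commuting with
`f`. -/
noncomputable def lift {Z : M} {g : Z ⟶ A} (h : Commutes f g) : Z ⟶ centralizer f :=
  equalizer.lift g (commutes_iff_comp_curry.1 h)

lemma lift_incl {Z : M} {g : Z ⟶ A} (h : Commutes f g) : lift h ≫ incl f = g :=
  equalizer.lift_ι _ _

noncomputable instance : MonObj (centralizer f) where
  one := lift (Commutes.one f)
  mul := lift ((commutes_incl f).mul (commutes_incl f))
  one_mul := by
    rw [← cancel_mono (incl f), Category.assoc, lift_incl, whiskerRight_comp_tensorHom_assoc,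
      lift_incl, MonObj.one_mul_hom]
  mul_one := by
    rw [← cancel_mono (incl f), Category.assoc, lift_incl, whiskerLeft_comp_tensorHom_assoc,
      lift_incl, MonObj.mul_one_hom]
  mul_assoc := by
    rw [← cancel_mono (incl f)]
    simp only [Category.assoc, lift_incl, whiskerRight_comp_tensorHom_assoc,
      whiskerLeft_comp_tensorHom_assoc]
    exact mul_assoc_tensorHom _ _ _

instance : IsMonHom (incl f) where
  one_hom := lift_incl (Commutes.one f)
  mul_hom := lift_incl ((commutes_incl f).mul (commutes_incl f))

end centralizer

/-- The centralizer of a generalized element as a subalgebra. -/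
noncomputable abbrev centralizerAlg {B : Mon M} {Z : M} (g : Z ⟶ B.X) : Mon M := ⟨centralizer g⟩

/-- The inclusion of the centralizer as a morphism of algebras. -/
noncomputable abbrev centralizerHom {B : Mon M} {Z : M} (g : Z ⟶ B.X) : centralizerAlg g ⟶ B :=
  Mon.Hom.mk (centralizer.incl g)

end Centralizer

section LieMorphisms

variable {M : Type u} [Category.{v} M] [MonoidalCategory M] [SymmetricCategory M]
  [Preadditive M] [MonoidalClosed M] [HasColimits M]

namespace ULieAlg

/-- The morphism of `M` underlying a morphism of unital Lie algebras `V ⟶ φ^* A`, with target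
written as the object underlying `A` instead of the (definitionally equal) one underlying
`φ^* A`. -/
def underlying {V : ULieAlg M} {A : Mon M} (φ : V ⟶ (phiStar M).obj A) : V.X ⟶ A.X := φ.hom

/-- The morphism of unital Lie algebras `V ⟶ φ^* A` with given underlying morphism. -/
def homMk {V : ULieAlg M} {A : Mon M} (f : V.X ⟶ A.X)
    (map_bracket : V.bracket ≫ f = (f ⊗ₘ f) ≫ commutator A.X)
    (map_unit : V.unit ≫ f = η[A.X]) : V ⟶ (phiStar M).obj A :=
  ⟨f, map_bracket, map_unit⟩

variable {V W : ULieAlg M} {A B : Mon M}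

lemma bracket_underlying (φ : V ⟶ (phiStar M).obj A) :
    V.bracket ≫ underlying φ = (underlying φ ⊗ₘ underlying φ) ≫ commutator A.X :=
  φ.bracket_hom

lemma unit_underlying (φ : V ⟶ (phiStar M).obj A) : V.unit ≫ underlying φ = η[A.X] :=
  φ.unit_hom

lemma underlying_ext {φ ψ : V ⟶ (phiStar M).obj A} (h : underlying φ = underlying ψ) :
    φ = ψ :=
  hom_ext h

lemma underlying_homMk (f : V.X ⟶ A.X) (map_bracket map_unit) :
    underlying (homMk f map_bracket map_unit) = f := rfl

lemma underlying_comp_map (φ : V ⟶ (phiStar M).obj A) (k : A ⟶ B) :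
    underlying (φ ≫ (phiStar M).map k) = underlying φ ≫ k.hom := rfl

lemma underlying_comp (g : W ⟶ V) (φ : V ⟶ (phiStar M).obj A) :
    underlying (g ≫ φ) = g.hom ≫ underlying φ := rfl

lemma commutes_underlying (φ : V ⟶ (phiStar M).obj A) {Y Z : M} {f : Y ⟶ V.X} {g : Z ⟶ V.X}
    (h : (f ⊗ₘ g) ≫ V.bracket = 0) : Commutes (f ≫ underlying φ) (g ≫ underlying φ) := by
  rw [commutes_iff, ← tensorHom_comp_tensorHom_assoc, ← bracket_underlying, reassoc_of% h,
    zero_comp]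

end ULieAlg

end LieMorphisms

section FieldTheoryOfLeftAdjoint

variable {M : Type u} [Category.{v} M] [MonoidalCategory M] [SymmetricCategory M]
  [Preadditive M] [MonoidalClosed M] [HasColimits M] [HasEqualizers M]

namespace ULieAlg

lemma exists_comp_map_eq_of_commutes {V : ULieAlg M} {A : Mon M} {Y : M} {f : Y ⟶ A.X}
    (φ : V ⟶ (phiStar M).obj A) (h : Commutes f (underlying φ)) :
    ∃ ψ : V ⟶ (phiStar M).obj (centralizerAlg f), ψ ≫ (phiStar M).map (centralizerHom f) = φ := by
  refine ⟨homMk (A := centralizerAlg f) (centralizer.lift h) ?_ ?_, underlying_ext ?_⟩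
  · have map_commutator := commutator_hom (centralizerHom f)
    rw [← cancel_mono (centralizer.incl f), Category.assoc, Category.assoc, map_commutator,
      centralizer.lift_incl, tensorHom_comp_tensorHom_assoc, centralizer.lift_incl,
      bracket_underlying]
  · rw [← cancel_mono (centralizer.incl f), Category.assoc, centralizer.lift_incl,
      unit_underlying]
    exact (IsMonHom.one_hom (centralizer.incl f)).symm
  · rw [underlying_comp_map, underlying_homMk]
    exact centralizer.lift_incl h

end ULieAlg

variable {F : ULieAlg M ⥤ Mon M}

lemma commutes_of_homEquiv (adj : F ⊣ phiStar M) {V : ULieAlg M} {A : Mon M} {Y : M}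
    {f : Y ⟶ A.X} {k : F.obj V ⟶ A}
    (h : Commutes f (ULieAlg.underlying (adj.homEquiv V A k))) : Commutes f k.hom := by
  obtain ⟨ψ, ψ_comp⟩ := ULieAlg.exists_comp_map_eq_of_commutes _ h
  have factorization : (adj.homEquiv V _).symm ψ ≫ centralizerHom f = k := by
    rw [← adj.homEquiv_naturality_right_symm, ψ_comp, Equiv.symm_apply_apply]
  rw [← factorization]
  exact (centralizer.commutes_incl f).precomp _

lemma commutes_map (adj : F ⊣ phiStar M) {V₁ V₂ V : ULieAlg M} {g₁ : V₁ ⟶ V} {g₂ : V₂ ⟶ V}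
    (h : (g₁.hom ⊗ₘ g₂.hom) ≫ V.bracket = 0) : Commutes (F.map g₁).hom (F.map g₂).hom := by
  have transpose {W : ULieAlg M} (g : W ⟶ V) : ULieAlg.underlying (adj.homEquiv W _ (F.map g)) =
      g.hom ≫ ULieAlg.underlying (adj.unit.app V) := by
    rw [adj.homEquiv_unit, adj.unit_naturality, ULieAlg.underlying_comp]
  have commutes_transpose := ULieAlg.commutes_underlying (adj.unit.app V) h
  rw [← transpose, ← transpose] at commutes_transpose
  exact (commutes_of_homEquiv adj (commutes_of_homEquiv adj commutes_transpose).symm).symm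

theorem isQFT_comp_of_adjunction (adj : F ⊣ phiStar M) {C : Type u₁} [Category.{v₁} C]
    {O : Orthogonality C} {B : C ⥤ ULieAlg M} (hB : isLFT M O B) : isQFT M O (B ⋙ F) := by
  intro c₁ c₂ c f₁ f₂ hf
  have bracket_eq_zero : ((B.map f₁).hom ⊗ₘ (B.map f₂).hom) ≫ (B.obj c).bracket = 0 :=
    (hB f₁ f₂ hf).trans comp_zero
  rw [comp_zero]
  exact (commutes_iff (A := (F.obj (B.obj c)).X)).1 (commutes_map adj bracket_eq_zero)

end FieldTheoryOfLeftAdjoint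

section EnvelopingAlgebra

variable {M : Type u} [Category.{v} M] [MonoidalCategory M] [SymmetricCategory M]
  [Preadditive M] [MonoidalClosed M] [HasColimits M]

namespace ULieAlg

/-- The extension to the universal enveloping algebra `U^⊗ V` of a morphism from `V` to an
associative algebra that sends brackets to commutators. -/
noncomputable def envAlgDesc {V : ULieAlg M} {A : Mon M} (f : V.X ⟶ A.X)
    (hf : V.bracket ≫ f = (f ⊗ₘ f) ≫ commutator A.X) : V.envAlg ⟶ A :=
  coequalizer.desc (lift f) (by
    have restrict_lift : ι₁ V.X ≫ (lift f).hom = f := ι₁_lift f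
    rw [lift_comp, lift_comp]
    congr 1
    rw [q₁, q₂, Category.assoc, Category.assoc, commutator_hom,
      tensorHom_comp_tensorHom_assoc, restrict_lift, hf])

lemma π_envAlgDesc {V : ULieAlg M} {A : Mon M} (f : V.X ⟶ A.X)
    (hf : V.bracket ≫ f = (f ⊗ₘ f) ≫ commutator A.X) : V.π ≫ envAlgDesc f hf = lift f :=
  coequalizer.π_desc _ _

/-- The algebra morphism `φ_!(V) ⟶ A` extending a morphism of unital Lie algebras `V ⟶ φ^* A`. -/
noncomputable def unitalEnvAlgDesc {V : ULieAlg M} {A : Mon M} (φ : V ⟶ (phiStar M).obj A) :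
    V.unitalEnvAlg ⟶ A :=
  coequalizer.desc (envAlgDesc (underlying φ) (bracket_underlying φ)) (by
    have π_desc : V.π.hom ≫ (envAlgDesc (underlying φ) (bracket_underlying φ)).hom =
        (lift (underlying φ)).hom := congrArg Mon.Hom.hom (π_envAlgDesc _ _)
    have restrict_lift : ι₁ V.X ≫ (lift (underlying φ)).hom = underlying φ := ι₁_lift _
    rw [lift_comp, lift_comp]
    congr 1
    rw [s₁, s₂, Category.assoc, Category.assoc, Category.assoc, π_desc, restrict_lift,
      IsMonHom.one_hom, unit_underlying])

lemma ι₁_unitalEnvAlgDesc {V : ULieAlg M} {A : Mon M} (φ : V ⟶ (phiStar M).obj A) :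
    ι₁ V.X ≫ (V.π ≫ V.piUnital ≫ unitalEnvAlgDesc φ).hom = underlying φ := by
  have piUnital_desc : V.piUnital ≫ unitalEnvAlgDesc φ =
      envAlgDesc (underlying φ) (bracket_underlying φ) := coequalizer.π_desc _ _
  rw [piUnital_desc, π_envAlgDesc]
  exact ι₁_lift _

lemma unitalEnvAlgDesc_comp {V W : ULieAlg M} {A : Mon M} (f : V ⟶ W)
    (φ : W ⟶ (phiStar M).obj A) :
    unitalEnvAlgDesc (f ≫ φ) = unitalEnvAlgMap f ≫ unitalEnvAlgDesc φ := by
  have map_eq := ι₁_unitalEnvAlgMap f =≫ (unitalEnvAlgDesc φ).hom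
  simp only [Category.assoc, ← Mon.comp_hom'] at map_eq
  apply unitalEnvAlg_hom_ext
  rw [map_eq, ι₁_unitalEnvAlgDesc, ι₁_unitalEnvAlgDesc, underlying_comp]

/-- The canonical morphism `V ⟶ φ^* φ_!(V)`. -/
noncomputable def toUnitalEnvAlg (V : ULieAlg M) : V ⟶ (phiStar M).obj V.unitalEnvAlg :=
  homMk (ι₁ V.X ≫ (V.π ≫ V.piUnital).hom)
    (by
      have bracket_eq := V.q_condition =≫ V.piUnital.hom
      rw [Category.assoc, Category.assoc, ← Mon.comp_hom', q₁, q₂, Category.assoc, Category.assoc,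
        commutator_hom, tensorHom_comp_tensorHom_assoc] at bracket_eq
      exact bracket_eq.symm)
    (by
      have unit_eq := V.s_condition
      rw [s₁, s₂, Category.assoc, Category.assoc, Category.assoc, ← Mon.comp_hom',
        IsMonHom.one_hom] at unit_eq
      exact unit_eq)

lemma underlying_toUnitalEnvAlg_comp_map {V : ULieAlg M} {A : Mon M} (k : V.unitalEnvAlg ⟶ A) :
    underlying (V.toUnitalEnvAlg ≫ (phiStar M).map k) =
      ι₁ V.X ≫ (V.π ≫ V.piUnital ≫ k).hom := by
  rw [underlying_comp_map, toUnitalEnvAlg, underlying_homMk, Category.assoc, ← Mon.comp_hom',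
    Category.assoc]

/-- Algebra morphisms `φ_!(V) ⟶ A` correspond to morphisms of unital Lie algebras `V ⟶ φ^* A`. -/
noncomputable def unitalEnvAlgHomEquiv (V : ULieAlg M) (A : Mon M) :
    (V.unitalEnvAlg ⟶ A) ≃ (V ⟶ (phiStar M).obj A) where
  toFun k := V.toUnitalEnvAlg ≫ (phiStar M).map k
  invFun := unitalEnvAlgDesc
  left_inv k := by
    apply unitalEnvAlg_hom_ext
    rw [ι₁_unitalEnvAlgDesc, underlying_toUnitalEnvAlg_comp_map]
  right_inv φ := by
    apply underlying_ext
    rw [underlying_toUnitalEnvAlg_comp_map, ι₁_unitalEnvAlgDesc]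

end ULieAlg

variable (M) in
/-- The adjunction `φ_! ⊣ φ^*`. -/
noncomputable def phiAdjunction : phiShriek M ⊣ phiStar M :=
  Adjunction.mkOfHomEquiv
    { homEquiv := ULieAlg.unitalEnvAlgHomEquiv
      homEquiv_naturality_left_symm := ULieAlg.unitalEnvAlgDesc_comp
      homEquiv_naturality_right := fun {V _ _} k l =>
        (V.toUnitalEnvAlg ≫= (phiStar M).map_comp k l).trans (Category.assoc _ _ _).symm }

variable {C : Type u₁} [Category.{v₁} C] {O : Orthogonality C}

/-- The restriction to field theories of the adjunction `φ_! ⊣ φ^*`, applied objectwise. -/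
noncomputable def fieldTheoryAdjunction
    (h : ∀ B : C ⥤ ULieAlg M, isLFT M O B → isQFT M O (B ⋙ phiShriek M)) :
    phiShriekRestricted h ⊣ Ulin M O :=
  ((phiAdjunction M).whiskerRight C).restrictFullyFaithful
    (isLFT M O).fullyFaithfulι (isQFT M O).fullyFaithfulι (Iso.refl _) (Iso.refl _)

end EnvelopingAlgebra

end LinearQuantization

theorem corollary5p3_general {M : Type*} [Category* M] [MonoidalCategory M] [SymmetricCategory M]
    [MonoidalClosed M] [Preadditive M] [HasEqualizers M] [HasColimits M]
    {C : Type*} [Category* C] (O : LinearQuantization.Orthogonality C) :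
    Nonempty (LinearQuantization.phiShriek M ⊣ LinearQuantization.phiStar M) ∧
    ∃ h : ∀ B : C ⥤ LinearQuantization.ULieAlg M, LinearQuantization.isLFT M O B →
        LinearQuantization.isQFT M O (B ⋙ LinearQuantization.phiShriek M),
      Nonempty (LinearQuantization.phiShriekRestricted h ⊣ LinearQuantization.Ulin M O) ∧
      ∀ Qlin : LinearQuantization.LFT M O ⥤ LinearQuantization.QFT M O,
        (Qlin ⊣ LinearQuantization.Ulin M O) →
          Nonempty (Qlin ≅ LinearQuantization.phiShriekRestricted h) :=
  ⟨⟨LinearQuantization.phiAdjunction M⟩,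
    fun _ => LinearQuantization.isQFT_comp_of_adjunction (LinearQuantization.phiAdjunction M),
    ⟨LinearQuantization.fieldTheoryAdjunction _⟩,
    fun _ adj => ⟨adj.leftAdjointUniq (LinearQuantization.fieldTheoryAdjunction _)⟩⟩

theorem corollary5p3 {M : Type*} [Category* M] [MonoidalCategory M] [SymmetricCategory M]
    [MonoidalClosed M] [Preadditive M] [HasLimits M] [HasColimits M]
    {C : Type*} [Category* C] (O : LinearQuantization.Orthogonality C) :
    Nonempty (LinearQuantization.phiShriek M ⊣ LinearQuantization.phiStar M) ∧
    ∃ h : ∀ B : C ⥤ LinearQuantization.ULieAlg M, LinearQuantization.isLFT M O B →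
        LinearQuantization.isQFT M O (B ⋙ LinearQuantization.phiShriek M),
      Nonempty (LinearQuantization.phiShriekRestricted h ⊣ LinearQuantization.Ulin M O) ∧
      ∀ Qlin : LinearQuantization.LFT M O ⥤ LinearQuantization.QFT M O,
        (Qlin ⊣ LinearQuantization.Ulin M O) →
          Nonempty (Qlin ≅ LinearQuantization.phiShriekRestricted h) :=
  corollary5p3_general O
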